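/- Let $n\ge 0$, let $\mathcal X_i,\mathcal Y_i$ ($0\le i\le n$) be Polish spaces with their Borel $\sigma$-algebras, put $\mathcal X_{0,k}=\prod_{i=0}^{k}\mathcal X_i$, $\mathcal Y_{0,k}=\prod_{i=0}^{k}\mathcal Y_i$ (with $\mathcal Y_{0,-1}$ a point), and assume that $\mathcal Y_{0,n}$ is compact. Let $P_{X^n}$ be a Borel probability measure on $\mathcal X_{0,n}$. Let $\mathcal Q(\mathcal Y_{0,n};\mathcal X_{0,n})$ be the set of all stochastic kernels $P(dy^n|x^n)$ on $\mathcal Y_{0,n}$ given $\mathcal X_{0,n}$, with the topology of weak convergence of probability measures: $P_\alpha\to P$ if and only if the joint distributions $P_\alpha(dy^n|x^n)\otimes P_{X^n}(dx^n)$ converge weakly to $P(dy^n|x^n)\otimes P_{X^n}(dx^n)$ on $\mathcal X_{0,n}\times\mathcal Y_{0,n}$ (so kernels that agree $P_{X^n}$-a.s. are not distinguished). Let $\overrightarrow Q_{ad}$ be the set of those $P\in\mathcal Q(\mathcal Y_{0,n};\mathcal X_{0,n})$ for which there are stochastic kernels $q_i(dy_i|y^{i-1},x^i)$ on $\mathcal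 Y_i$ given $\mathcal Y_{0,i-1}\times\mathcal X_{0,i}$, $0\le i\le n$, with $$P(dy^n|x^n)=\bigotimes_{i=0}^n q_i(dy_i|y^{i-1},x^i)\quad\text{for } P_{X^n}\text{-almost every } x^n .$$ 1) $\mathcal Q(\mathcal Y_{0,n};\mathcal X_{0,n})$ is compact, and $\overrightarrow Q_{ad}$ is a closed subset of it, hence compact. 2) Let $\rho_{0,i}:\mathcal X_{0,i}\times\mathcal Y_{0,i}\to[0,\infty)$, $0\le i\le n$, be Borel measurable, let $d_{0,n}(x^n,y^n)=\sum_{i=0}^n\rho_{0,i}(x^i,y^i)$, and let $D\ge 0$. Assume that $d_{0,n}(x^n,\cdot)$ is continuous on $\mathcal Y_{0,n}$ for every $x^n\in\mathcal X_{0,n}$, and that $d_{0,n}(x^n,y^n)<D$ for some $(x^n,y^n)\in\mathcal X_{0,n}\times\mathcal Y_{0,n}$. Then $$\overrightarrow Q_{0,n}(D)=\Big\{P\in\overrightarrow Q_{ad}:\ \int_{\mathcal X_{0,n}\times\mathcal Y_{0,n}} d_{0,n}(x^n,y^n)\,P(dy^n|x^n)\otimes P_{X^n}(dx^n)\le D\Big\}$$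 is a closed subset of $\mathcal Q(\mathcal Y_{0,n};\mathcal X_{0,n})$ contained in $\overrightarrow Q_{ad}$ (hence closed in $\overrightarrow Q_{ad}$), and it is compact. -/

import Mathlib

open MeasureTheory ProbabilityTheory
open scoped NNReal ENNReal

noncomputable section

namespace CausalRDF

/-- `CondDist μ β` is the set of conditional distributions on `β` given an `α`-valued variable of
law `μ`, that is, the set of all stochastic (Markov) kernels from `α` to `β`. The law `μ` enters
only through the topology below. -/
def CondDist {α : Type*} [MeasurableSpace α] (_μ : ProbabilityMeasure α)
    (β : Type*) [MeasurableSpace β] : Type _ :=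
  {κ : Kernel α β // IsMarkovKernel κ}

/-- The joint distribution `P(dy | x) ⊗ μ(dx)` on `α × β`. -/
def CondDist.joint {α β : Type*} [MeasurableSpace α] [MeasurableSpace β]
    {μ : ProbabilityMeasure α} (P : CondDist μ β) : ProbabilityMeasure (α × β) :=
  haveI := P.2
  ⟨(μ : Measure α) ⊗ₘ P.1, inferInstance⟩

/-- The topology of weak convergence of probability measures: `P_a → P` means that the joint
distributions `P_a(dy | x) ⊗ μ(dx)` converge weakly to `P(dy | x) ⊗ μ(dx)`. Kernels that agree
`μ`-almost surely are not separated. -/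
instance {α β : Type*} [TopologicalSpace α] [MeasurableSpace α] [TopologicalSpace β]
    [MeasurableSpace β] [OpensMeasurableSpace (α × β)] (μ : ProbabilityMeasure α) :
    TopologicalSpace (CondDist μ β) :=
  TopologicalSpace.induced CondDist.joint inferInstance

/-- `Seq X k` is the space `X_0 × ⋯ × X_{k-1}` (a one-point space if `k = 0`). -/
abbrev Seq (X : ℕ → Type*) (k : ℕ) : Type _ := (j : Fin k) → X j

/-- The initial segment `(x_0, …, x_{k-1})` of `(x_0, …, x_{m-1})`, where `k ≤ m`. -/
def Seq.restrict {X : ℕ → Type*} {k m : ℕ} (h : k ≤ m) (x : Seq X m) : Seq X k :=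
  fun j => x (Fin.castLE h j)

/-- `((y_0, …, y_{k-1}), y_k) ↦ (y_0, …, y_k)`. -/
def Seq.append {Y : ℕ → Type*} {k : ℕ} (p : Seq Y k × Y k) : Seq Y (k + 1) :=
  Fin.snoc (α := fun j : Fin (k + 1) => Y j) p.1 p.2

theorem Seq.measurable_restrict {X : ℕ → Type*} [∀ i, MeasurableSpace (X i)] {k m : ℕ}
    (h : k ≤ m) : Measurable (Seq.restrict (X := X) h) :=
  measurable_pi_lambda _ fun j => measurable_pi_apply (Fin.castLE h j)

theorem Seq.measurable_append {Y : ℕ → Type*} [∀ i, MeasurableSpace (Y i)] {k : ℕ} :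
    Measurable (Seq.append (Y := Y) (k := k)) := by
  refine measurable_pi_lambda _ fun j => ?_
  refine Fin.lastCases ?_ (fun j => ?_) j
  · simpa [Seq.append] using measurable_snd
  · have h : Measurable fun p : Seq Y k × Y k => p.1 j :=
      (measurable_pi_apply j).comp measurable_fst
    simpa [Seq.append] using h

/-- The causal convolution product `⊗_{i<k} q_i(dy_i | y^{i-1}, x^i)` of kernels
`q_i(dy_i | x^i, y^{i-1})`, where `x^i = (x_0, …, x_i)` and `y^{i-1} = (y_0, …, y_{i-1})`. -/
def causalProduct {X Y : ℕ → Type*} [∀ i, MeasurableSpace (X i)] [∀ i, MeasurableSpace (Y i)] :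
    (k : ℕ) → ((i : Fin k) → Kernel (Seq X (i + 1) × Seq Y i) (Y i)) →
      Kernel (Seq X k) (Seq Y k)
  | 0, _ => Kernel.const _ (Measure.dirac fun j => j.elim0)
  | k + 1, q =>
      (((causalProduct k fun i => q i.castSucc).comap (Seq.restrict k.le_succ)
          (Seq.measurable_restrict k.le_succ)) ⊗ₖ
        (q (Fin.last k) : Kernel (Seq X (k + 1) × Seq Y k) (Y k))).map Seq.append

/-- The realizability constraint set: all conditional distributions of `Y^n` given `X^n` that are
almost surely equal to a causal product of stochastic kernels `q_i(dy_i | y^{i-1}, x^i)`,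
`0 ≤ i ≤ n`. -/
def realizable {X Y : ℕ → Type*} [∀ i, MeasurableSpace (X i)] [∀ i, MeasurableSpace (Y i)]
    {n : ℕ} (μ : ProbabilityMeasure (Seq X (n + 1))) : Set (CondDist μ (Seq Y (n + 1))) :=
  {P | ∃ q : (i : Fin (n + 1)) → Kernel (Seq X (i + 1) × Seq Y i) (Y i),
      (∀ i, IsMarkovKernel (q i)) ∧
        ∀ᵐ x ∂(μ : Measure (Seq X (n + 1))), P.1 x = causalProduct (n + 1) q x}

/-- The distortion `d_{0,n}(x^n, y^n) = ∑_{i=0}^n ρ_{0,i}(x^i, y^i)`. -/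
def distortion {X Y : ℕ → Type*} {n : ℕ}
    (ρ : (i : Fin (n + 1)) → Seq X (i + 1) × Seq Y (i + 1) → ℝ≥0)
    (x : Seq X (n + 1)) (y : Seq Y (n + 1)) : ℝ≥0 :=
  ∑ i : Fin (n + 1), ρ i (Seq.restrict i.isLt x, Seq.restrict i.isLt y)

/-- The realizable conditional distributions whose average distortion
`∫ d_{0,n}(x^n, y^n) P(dy^n | x^n) ⊗ μ(dx^n)` is at most `D`. -/
def fidelity {X Y : ℕ → Type*} [∀ i, MeasurableSpace (X i)] [∀ i, MeasurableSpace (Y i)]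
    {n : ℕ} (μ : ProbabilityMeasure (Seq X (n + 1)))
    (ρ : (i : Fin (n + 1)) → Seq X (i + 1) × Seq Y (i + 1) → ℝ≥0) (D : ℝ≥0) :
    Set (CondDist μ (Seq Y (n + 1))) :=
  {P | ∫⁻ p : Seq X (n + 1) × Seq Y (n + 1), (distortion ρ p.1 p.2 : ℝ≥0∞)
      ∂(P.joint : Measure (Seq X (n + 1) × Seq Y (n + 1))) ≤ D} ∩ realizable μ

end CausalRDF

end

/-!
A weak limit of joint laws with a fixed first marginal `μ` may be taken against integrands that are
merely measurable in `x`: by density of `C_b(X)` in `L¹(μ)`, integrals of `H x y` with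
`H ∈ L¹(μ; C_b(Y))` depend continuously on the joint law.

A kernel is a causal product iff, for every `k`, the law of `y^{k-1}` given `x^n` depends on
`x^{k-1}` only; the factors are then recovered by disintegrating these laws one coordinate at a
time. This is conditional independence of `x^n` and `y^{k-1}` given `x^{k-1}`, which amounts to
`E[f(x^n) g(y^{k-1})] = E[E[f(x^n) | x^{k-1}] g(y^{k-1})]` for all bounded continuous `f` and `g`.
Both sides are continuous in the joint law, so the realizable kernels form a closed set.

Compactness of the space of kernels is Prokhorov's theorem: the joint laws are exactly the measures
with first marginal `μ`, and these are tight because the second factor is compact. Truncating the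
distortion makes its average a supremum of continuous functions, so its sublevel sets are closed.
-/

namespace CausalRDF

open Topology Filter BoundedContinuousFunction

namespace CondDist

section Joint

variable {α β : Type*} [MeasurableSpace α] [MeasurableSpace β] {μ : ProbabilityMeasure α}

theorem map_fst_joint (P : CondDist μ β) : (P.joint : Measure (α × β)).map Prod.fst = μ :=
  have := P.2
  Measure.fst_compProd (μ : Measure α) P.1

theorem measurePreserving_fst (P : CondDist μ β) :
    MeasurePreserving Prod.fst (P.joint : Measure (α × β)) (μ : Measure α) :=
  ⟨measurable_fst, P.map_fst_joint⟩

theorem nonempty (P : CondDist μ β) : Nonempty β :=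
  P.joint.nonempty.map Prod.snd

theorem range_joint [StandardBorelSpace β] [Nonempty β] :
    Set.range (joint : CondDist μ β → ProbabilityMeasure (α × β)) =
      {ν | ν.map measurable_fst.aemeasurable = μ} := by
  ext ν
  refine ⟨?_, fun hν => ⟨⟨(ν : Measure (α × β)).condKernel, inferInstance⟩, Subtype.ext ?_⟩⟩
  · rintro ⟨P, rfl⟩
    exact Subtype.ext P.map_fst_joint
  · have hfst : (ν : Measure (α × β)).fst = μ := congrArg Subtype.val hν
    change (μ : Measure α) ⊗ₘ (ν : Measure (α × β)).condKernel = ν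
    rw [← hfst]
    exact (ν : Measure (α × β)).disintegrate _

theorem isInducing_joint [TopologicalSpace α] [TopologicalSpace β]
    [OpensMeasurableSpace (α × β)] :
    IsInducing (joint : CondDist μ β → ProbabilityMeasure (α × β)) :=
  ⟨rfl⟩

end Joint

end CondDist

theorem isTightMeasureSet_setOf_map_fst_mem {α β : Type*}
    [TopologicalSpace α] [T2Space α] [MeasurableSpace α] [OpensMeasurableSpace α]
    [TopologicalSpace β] [CompactSpace β] [MeasurableSpace β]
    {T : Set (Measure α)} (hT : IsTightMeasureSet T) :
    IsTightMeasureSet {ν : Measure (α × β) | ν.map Prod.fst ∈ T} := by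
  rw [isTightMeasureSet_iff_exists_isCompact_measure_compl_le] at hT ⊢
  intro ε hε
  obtain ⟨K, hK, hKε⟩ := hT ε hε
  refine ⟨Prod.fst ⁻¹' K, ?_, fun ν hν => ?_⟩
  · exact Set.prod_univ (s := K) (β := β) ▸ hK.prod isCompact_univ
  · rw [← Set.preimage_compl, ← Measure.map_apply measurable_fst hK.measurableSet.compl]
    exact hKε _ hν

namespace CondDist

instance compactSpace {α β : Type*}
    [TopologicalSpace α] [PolishSpace α] [MeasurableSpace α] [BorelSpace α]
    [TopologicalSpace β] [PolishSpace β] [CompactSpace β] [MeasurableSpace β] [BorelSpace β]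
    {μ : ProbabilityMeasure α} : CompactSpace (CondDist μ β) := by
  rcases isEmpty_or_nonempty (CondDist μ β) with _ | ⟨⟨P⟩⟩
  · infer_instance
  have := P.nonempty
  rw [← isCompact_univ_iff, isInducing_joint.isCompact_iff, Set.image_univ, range_joint]
  let _ := TopologicalSpace.upgradeIsCompletelyMetrizable α
  set S : Set (ProbabilityMeasure (α × β)) := {ν | ν.map measurable_fst.aemeasurable = μ}
  have hS : IsClosed S :=
    isClosed_eq (ProbabilityMeasure.continuous_map continuous_fst) continuous_const
  have hS_tight : IsTightMeasureSet {(ν : Measure (α × β)) | ν ∈ S} := by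
    refine (isTightMeasureSet_setOf_map_fst_mem
      (isTightMeasureSet_singleton (μ := (μ : Measure α)))).subset ?_
    rintro _ ⟨ν, hν, rfl⟩
    exact congrArg Subtype.val hν
  simpa only [hS.closure_eq] using isCompact_closure_of_isTightMeasureSet hS_tight

section Integral

variable {α β : Type*} [MeasurableSpace α] [TopologicalSpace β]
  [TopologicalSpace.PseudoMetrizableSpace β] [SecondCountableTopology β]
  [MeasurableSpace β] [OpensMeasurableSpace β] {μ : ProbabilityMeasure α}

theorem integrable_apply {H : α → β →ᵇ ℝ} (hH : Integrable H (μ : Measure α))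
    (P : CondDist μ β) :
    Integrable (fun p : α × β => H p.1 p.2) (P.joint : Measure (α × β)) := by
  have hfst := P.measurePreserving_fst
  refine (hfst.integrable_comp_of_integrable hH).norm.mono' ?_
    (ae_of_all _ fun p => (H p.1).norm_coe_le_norm p.2)
  exact continuous_eval.comp_aestronglyMeasurable
    ((hH.1.comp_measurePreserving hfst).prodMk measurable_snd.aestronglyMeasurable)

theorem dist_integral_apply_le {H G : α → β →ᵇ ℝ} (hH : Integrable H (μ : Measure α))
    (hG : Integrable G (μ : Measure α)) (P : CondDist μ β) :
    dist (∫ p : α × β, H p.1 p.2 ∂(P.joint : Measure (α × β)))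
      (∫ p : α × β, G p.1 p.2 ∂(P.joint : Measure (α × β))) ≤
      ∫ x, ‖H x - G x‖ ∂(μ : Measure α) := by
  have hfst := P.measurePreserving_fst
  have hHG := (hH.sub hG).norm
  calc dist (∫ p : α × β, H p.1 p.2 ∂(P.joint : Measure (α × β)))
        (∫ p : α × β, G p.1 p.2 ∂(P.joint : Measure (α × β)))
    _ = ‖∫ p : α × β, (H p.1 - G p.1) p.2 ∂(P.joint : Measure (α × β))‖ := by
        rw [dist_eq_norm, ← integral_sub (P.integrable_apply hH) (P.integrable_apply hG)]
        rfl
    _ ≤ ∫ p : α × β, ‖H p.1 - G p.1‖ ∂(P.joint : Measure (α × β)) :=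
        norm_integral_le_of_norm_le (hfst.integrable_comp_of_integrable hHG)
          (ae_of_all _ fun p => (H p.1 - G p.1).norm_coe_le_norm p.2)
    _ = ∫ x, ‖H x - G x‖ ∂(μ : Measure α) := by
        rw [← hfst.map_eq, integral_map measurable_fst.aemeasurable
          (hfst.map_eq.symm ▸ hHG.aestronglyMeasurable)]

variable [TopologicalSpace α] [TopologicalSpace.PseudoMetrizableSpace α] [BorelSpace α]

theorem continuous_integral_apply {H : α → β →ᵇ ℝ} (hH : Integrable H (μ : Measure α)) :
    Continuous fun P : CondDist μ β =>
      ∫ p : α × β, H p.1 p.2 ∂(P.joint : Measure (α × β)) := by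
  rw [← continuousOn_univ]
  refine continuousOn_of_uniform_approx_of_continuousOn fun u hu => ?_
  obtain ⟨ε, hε, hεu⟩ := Metric.mem_uniformity_dist.1 hu
  obtain ⟨g, hg, hgi⟩ := hH.exists_boundedContinuous_integral_sub_le (half_pos hε)
  let G : (α × β) →ᵇ ℝ := .ofNormedAddCommGroup (fun p : α × β => g p.1 p.2) (by fun_prop) ‖g‖
    fun p => ((g p.1).norm_coe_le_norm p.2).trans (g.norm_coe_le_norm p.1)
  refine ⟨fun P => ∫ p, G p ∂(P.joint : Measure (α × β)), ?_, fun P _ => hεu ?_⟩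
  · exact ((ProbabilityMeasure.continuous_integral_boundedContinuousFunction G).comp
      isInducing_joint.continuous).continuousOn
  · exact (P.dist_integral_apply_le hH hgi).trans_lt (hg.trans_lt (half_lt_self hε))

theorem continuous_integral_mul {f : α → ℝ} (hf : Integrable f (μ : Measure α)) (g : β →ᵇ ℝ) :
    Continuous fun P : CondDist μ β =>
      ∫ p : α × β, f p.1 * g p.2 ∂(P.joint : Measure (α × β)) :=
  continuous_integral_apply (hf.smul_const g)

end Integral

end CondDist

theorem stronglyMeasurable_of_measurable_apply {α β : Type*} [MeasurableSpace α]
    [TopologicalSpace β] [PolishSpace β] [CompactSpace β] {h : α → C(β, ℝ)}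
    (hh : ∀ y, Measurable fun x => h x y) : StronglyMeasurable h := by
  borelize C(β, ℝ)
  rcases isEmpty_or_nonempty β with hβ | hβ
  · exact (measurable_of_subsingleton_codomain h).stronglyMeasurable
  let e : C(β, ℝ) → ℕ → ℝ := fun f k => f (TopologicalSpace.denseSeq β k)
  have he : Continuous e := continuous_pi fun k => continuous_eval_const _
  have he_inj : Function.Injective e := fun f g hfg => DFunLike.coe_injective
    ((TopologicalSpace.denseRange_denseSeq β).equalizer f.continuous g.continuous hfg)
  have : Measurable h := (he.measurableEmbedding he_inj).measurable_comp_iff.1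
    (measurable_pi_lambda _ fun k => hh _)
  exact this.stronglyMeasurable

namespace CondDist

section Caratheodory

variable {α β : Type*}
  [TopologicalSpace α] [TopologicalSpace.PseudoMetrizableSpace α]
  [MeasurableSpace α] [BorelSpace α]
  [TopologicalSpace β] [PolishSpace β] [CompactSpace β] [MeasurableSpace β] [BorelSpace β]
  {μ : ProbabilityMeasure α}

theorem continuous_integral_of_measurable_of_continuous {h : α × β → ℝ} (hm : Measurable h)
    (hc : ∀ x, Continuous fun y => h (x, y)) {C : ℝ} (hC : ∀ p, |h p| ≤ C) :
    Continuous fun P : CondDist μ β => ∫ p, h p ∂(P.joint : Measure (α × β)) := by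
  let H : α → C(β, ℝ) := fun x => ⟨fun y => h (x, y), hc x⟩
  let e := ContinuousMap.isometryEquivBoundedOfCompact β ℝ
  have hH : StronglyMeasurable (e ∘ H) := e.isometry.continuous.comp_stronglyMeasurable
    (stronglyMeasurable_of_measurable_apply fun y => hm.comp measurable_prodMk_right)
  refine continuous_integral_apply (H := e ∘ H) (.of_bound hH.aestronglyMeasurable (max C 0)
    (ae_of_all _ fun x => ?_))
  exact (norm_le (le_max_right _ _)).2 fun y => (hC (x, y)).trans (le_max_left _ _)

theorem lowerSemicontinuous_lintegral {d : α × β → ℝ≥0} (hm : Measurable d)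
    (hc : ∀ x, Continuous fun y => d (x, y)) :
    LowerSemicontinuous fun P : CondDist μ β =>
      ∫⁻ p, d p ∂(P.joint : Measure (α × β)) := by
  have hm_min (N : ℕ) : Measurable fun p => min (d p) (N : ℝ≥0) := hm.min measurable_const
  have hmin_le (N : ℕ) (p : α × β) : |((min (d p) N : ℝ≥0) : ℝ)| ≤ N := by
    rw [NNReal.abs_eq]
    exact_mod_cast min_le_right _ _
  have hsup (p : α × β) : (d p : ℝ≥0∞) = ⨆ N : ℕ, ((min (d p) N : ℝ≥0) : ℝ≥0∞) := by
    refine le_antisymm ?_ (iSup_le fun N => ENNReal.coe_le_coe.2 (min_le_left _ _))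
    obtain ⟨N, hN⟩ := exists_nat_ge (d p)
    exact le_iSup_of_le N (by rw [min_eq_left hN])
  have hmono : Monotone fun (N : ℕ) p => ((min (d p) N : ℝ≥0) : ℝ≥0∞) := fun N M hNM p =>
    ENNReal.coe_le_coe.2 (min_le_min_left _ (Nat.cast_le.2 hNM))
  simp_rw [hsup, lintegral_iSup (fun N => (hm_min N).coe_nnreal_ennreal) hmono]
  refine lowerSemicontinuous_iSup fun N => Continuous.lowerSemicontinuous ?_
  have hint (P : CondDist μ β) : Integrable (fun p => ((min (d p) N : ℝ≥0) : ℝ))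
      (P.joint : Measure (α × β)) :=
    .of_bound (hm_min N).coe_nnreal_real.aestronglyMeasurable N (ae_of_all _ (hmin_le N))
  simp_rw [fun P => lintegral_coe_eq_integral _ (hint P)]
  exact ENNReal.continuous_ofReal.comp (continuous_integral_of_measurable_of_continuous
    (hm_min N).coe_nnreal_real
    (fun x => NNReal.continuous_coe.comp ((hc x).min continuous_const)) (hmin_le N))

end Caratheodory

end CondDist

section CondExp

variable {α γ δ : Type*} [MeasurableSpace α] [mγ : MeasurableSpace γ] [MeasurableSpace δ]
  {μ : Measure α} {r : α → γ}

theorem map_prodMap_compProd_comap [SFinite μ] (hr : Measurable r)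
    (κ : Kernel γ δ) [IsSFiniteKernel κ] :
    (μ ⊗ₘ κ.comap r hr).map (Prod.map r id) = μ.map r ⊗ₘ κ := by
  refine Measure.ext_of_lintegral _ fun f hf => ?_
  rw [lintegral_map hf (by fun_prop), Measure.lintegral_compProd (by fun_prop),
    Measure.lintegral_compProd hf, lintegral_map (by fun_prop) hr]
  rfl

theorem integral_condExp_mul [IsFiniteMeasure μ] (hr : Measurable r)
    {f g : α → ℝ} (hf : Integrable f μ) (hg : StronglyMeasurable[mγ.comap r] g)
    (hfg : Integrable (f * g) μ) :
    ∫ x, (μ[f | mγ.comap r]) x * g x ∂μ = ∫ x, f x * g x ∂μ :=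
  calc ∫ x, (μ[f | mγ.comap r]) x * g x ∂μ
    _ = ∫ x, (μ[f * g | mγ.comap r]) x ∂μ :=
        integral_congr_ae (condExp_mul_of_stronglyMeasurable_right hg hfg hf).symm
    _ = ∫ x, f x * g x ∂μ := integral_condExp hr.comap_le

theorem integral_fst_mul_snd_compProd [SFinite μ] {κ : Kernel α δ} [IsMarkovKernel κ]
    [TopologicalSpace δ] [OpensMeasurableSpace δ]
    {f : α → ℝ} (hf : Integrable f μ) (g : δ →ᵇ ℝ) :
    ∫ p, f p.1 * g p.2 ∂(μ ⊗ₘ κ) = ∫ x, f x * ∫ y, g y ∂(κ x) ∂μ := by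
  have hfst : MeasurePreserving Prod.fst (μ ⊗ₘ κ) μ := ⟨measurable_fst, Measure.fst_compProd μ κ⟩
  have hg : Measurable fun p : α × δ => g p.2 := g.continuous.measurable.comp measurable_snd
  have hfg : Integrable (fun p : α × δ => f p.1 * g p.2) (μ ⊗ₘ κ) :=
    (hfst.integrable_comp_of_integrable hf).mul_bdd (c := ‖g‖) hg.aestronglyMeasurable
      (ae_of_all _ fun p => g.norm_coe_le_norm p.2)
  rw [Measure.integral_compProd hfg]
  simp_rw [integral_const_mul]

theorem integral_condExp_mul_compProd_comap [IsFiniteMeasure μ] (hr : Measurable r)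
    (κ : Kernel γ δ) [IsMarkovKernel κ] [TopologicalSpace δ] [OpensMeasurableSpace δ]
    {f : α → ℝ} (hf : Integrable f μ) (g : δ →ᵇ ℝ) :
    ∫ p, (μ[f | mγ.comap r]) p.1 * g p.2 ∂(μ ⊗ₘ κ.comap r hr) =
      ∫ p, f p.1 * g p.2 ∂(μ ⊗ₘ κ.comap r hr) := by
  have hg : StronglyMeasurable[mγ.comap r] fun x => ∫ y, g y ∂(κ.comap r hr x) :=
    (StronglyMeasurable.integral_kernel (κ := κ)
      g.continuous.measurable.stronglyMeasurable).comp_measurable (comap_measurable r)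
  have hfg : Integrable (f * fun x => ∫ y, g y ∂(κ.comap r hr x)) μ :=
    hf.mul_bdd (c := ‖g‖) (hg.mono hr.comap_le).aestronglyMeasurable
      (ae_of_all _ fun x => g.norm_integral_le_norm _)
  rw [integral_fst_mul_snd_compProd integrable_condExp, integral_fst_mul_snd_compProd hf,
    integral_condExp_mul hr hf hg hfg]

theorem ext_of_integral_condExp_mul [TopologicalSpace α] [BorelSpace α] [HasOuterApproxClosed α]
    [TopologicalSpace δ] [BorelSpace δ] [HasOuterApproxClosed δ] (hr : Measurable r)
    {ν₁ ν₂ : Measure (α × δ)} [IsFiniteMeasure ν₁] [IsFiniteMeasure ν₂]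
    (h₁ : ∀ (f : α →ᵇ ℝ) (g : δ →ᵇ ℝ),
      ∫ p, f p.1 * g p.2 ∂ν₁ = ∫ p, (μ[f | mγ.comap r]) p.1 * g p.2 ∂ν₁)
    (h₂ : ∀ (f : α →ᵇ ℝ) (g : δ →ᵇ ℝ),
      ∫ p, f p.1 * g p.2 ∂ν₂ = ∫ p, (μ[f | mγ.comap r]) p.1 * g p.2 ∂ν₂)
    (h : ν₁.map (Prod.map r id) = ν₂.map (Prod.map r id)) : ν₁ = ν₂ := by
  refine Measure.ext_of_integral_mul_boundedContinuousFunction fun f g => ?_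
  have hf : Measurable[mγ.comap r] (μ[f | mγ.comap r]) := stronglyMeasurable_condExp.measurable
  obtain ⟨φ, hφ, hφr⟩ := hf.exists_eq_measurable_comp
  have hφg : Measurable fun q : γ × δ => φ q.1 * g q.2 :=
    (hφ.comp measurable_fst).mul (g.continuous.measurable.comp measurable_snd)
  -- Being a function of `r`, the conditional expectation sees only the law of `(r x, y)`.
  have hmap (ν : Measure (α × δ)) : ∫ p, (μ[f | mγ.comap r]) p.1 * g p.2 ∂ν =
      ∫ q, φ q.1 * g q.2 ∂(ν.map (Prod.map r id)) := by
    rw [integral_map (by fun_prop) hφg.aestronglyMeasurable, hφr]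
    rfl
  rw [h₁, h₂, hmap, hmap, h]

end CondExp

namespace CondDist

variable {α β γ δ : Type*} [MeasurableSpace α] [MeasurableSpace β]
  [mγ : MeasurableSpace γ] [MeasurableSpace δ]
  {μ : ProbabilityMeasure α} {r : α → γ} {s : β → δ}

/-- `P.FactorsThrough r s` says that, given `x`, the conditional law of `s y` under `P` depends on
`x` only through `r x`; equivalently, `s y` and `x` are conditionally independent given `r x`. -/
def FactorsThrough (P : CondDist μ β) (r : α → γ) (s : β → δ) : Prop :=
  ∃ κ : Kernel γ δ, IsMarkovKernel κ ∧ ∀ᵐ x ∂(μ : Measure α), (P.1 x).map s = κ (r x)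

theorem ae_map_eq_comap_iff [MeasurableSpace.CountableOrCountablyGenerated α δ]
    (P : CondDist μ β) (hr : Measurable r) (hs : Measurable s)
    (κ : Kernel γ δ) [IsMarkovKernel κ] :
    (∀ᵐ x ∂(μ : Measure α), (P.1 x).map s = κ (r x)) ↔
      (P.joint : Measure (α × β)).map (Prod.map id s) = (μ : Measure α) ⊗ₘ κ.comap r hr := by
  have := P.2
  change _ ↔ ((μ : Measure α) ⊗ₘ P.1).map (Prod.map id s) = _
  rw [← Measure.compProd_map hs, Kernel.compProd_eq_iff]
  simp only [EventuallyEq, Kernel.map_apply _ hs, Kernel.comap_apply]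

theorem factorsThrough_iff [TopologicalSpace α] [BorelSpace α] [HasOuterApproxClosed α]
    [TopologicalSpace δ] [PolishSpace δ] [BorelSpace δ] (P : CondDist μ β) (hr : Measurable r)
    (hs : Measurable s) :
    P.FactorsThrough r s ↔ ∀ (f : α →ᵇ ℝ) (g : δ →ᵇ ℝ),
      ∫ p, f p.1 * g (s p.2) ∂(P.joint : Measure (α × β)) =
        ∫ p, ((μ : Measure α)[f | mγ.comap r]) p.1 * g (s p.2) ∂(P.joint : Measure (α × β)) := by
  set ν : Measure (α × δ) := (P.joint : Measure (α × β)).map (Prod.map id s) with hν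
  have hmap {f : α → ℝ} (hf : StronglyMeasurable f) (g : δ →ᵇ ℝ) :
      ∫ p, f p.1 * g (s p.2) ∂(P.joint : Measure (α × β)) = ∫ q, f q.1 * g q.2 ∂ν := by
    rw [hν, integral_map (by fun_prop)]
    · rfl
    · exact (hf.comp_measurable measurable_fst).aestronglyMeasurable.mul (by fun_prop)
  have hcond (f : α →ᵇ ℝ) : StronglyMeasurable ((μ : Measure α)[f | mγ.comap r]) :=
    stronglyMeasurable_condExp.mono hr.comap_le
  simp_rw [fun f : α →ᵇ ℝ => hmap f.continuous.measurable.stronglyMeasurable,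
    fun f : α →ᵇ ℝ => hmap (hcond f)]
  constructor
  · rintro ⟨κ, hκ, h⟩ f g
    rw [ae_map_eq_comap_iff P hr hs, ← hν] at h
    rw [h, integral_condExp_mul_compProd_comap hr κ (f.integrable _)]
  · intro h
    have : Nonempty δ := P.nonempty.map s
    let κ := condDistrib (s ∘ Prod.snd) (r ∘ Prod.fst) (P.joint : Measure (α × β))
    refine ⟨κ, inferInstance, (ae_map_eq_comap_iff P hr hs κ).2 ?_⟩
    refine ext_of_integral_condExp_mul hr h (fun f g =>
      (integral_condExp_mul_compProd_comap hr κ (f.integrable _) g).symm) ?_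
    rw [map_prodMap_compProd_comap, ← P.map_fst_joint, Measure.map_map hr measurable_fst,
      compProd_map_condDistrib (by fun_prop), Measure.map_map (by fun_prop) (by fun_prop)]
    rfl

theorem isClosed_setOf_factorsThrough
    [TopologicalSpace α] [TopologicalSpace.PseudoMetrizableSpace α] [BorelSpace α]
    [TopologicalSpace β] [TopologicalSpace.PseudoMetrizableSpace β] [SecondCountableTopology β]
    [OpensMeasurableSpace β] [TopologicalSpace δ] [PolishSpace δ] [BorelSpace δ]
    (hr : Measurable r) (hs : Continuous s) :
    IsClosed {P : CondDist μ β | P.FactorsThrough r s} := by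
  simp_rw [factorsThrough_iff _ hr hs.measurable, Set.ofPred_forall]
  exact isClosed_iInter fun f => isClosed_iInter fun g => isClosed_eq
    (continuous_integral_mul (f.integrable _) (g.compContinuous ⟨s, hs⟩))
    (continuous_integral_mul integrable_condExp (g.compContinuous ⟨s, hs⟩))

end CondDist

section Seq

variable {X Y : ℕ → Type*}

theorem Seq.restrict_append {k m : ℕ} (h : k ≤ m) (p : Seq Y m × Y m) :
    Seq.restrict (h.trans m.le_succ) (Seq.append p) = Seq.restrict h p.1 := by
  funext j
  exact Fin.snoc_castSucc (α := fun j : Fin (m + 1) => Y j) p.2 p.1 (Fin.castLE h j)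

theorem Seq.append_restrict {k : ℕ} (y : Seq Y (k + 1)) :
    Seq.append (Seq.restrict k.le_succ y, y (Fin.last k)) = y :=
  Fin.snoc_init_self (α := fun j : Fin (k + 1) => Y j) y

theorem Seq.continuous_restrict [∀ i, TopologicalSpace (Y i)] {k m : ℕ} (h : k ≤ m) :
    Continuous (Seq.restrict (X := Y) h) :=
  continuous_pi fun j => continuous_apply (Fin.castLE h j)

end Seq

section CausalProduct

variable {X Y : ℕ → Type*} [∀ i, MeasurableSpace (X i)] [∀ i, MeasurableSpace (Y i)]

instance isMarkovKernel_causalProduct (k : ℕ)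
    (q : (i : Fin k) → Kernel (Seq X (i + 1) × Seq Y i) (Y i)) [hq : ∀ i, IsMarkovKernel (q i)] :
    IsMarkovKernel (causalProduct k q) := by
  induction k with
  | zero => rw [causalProduct]; infer_instance
  | succ k ih =>
    have := ih (fun i => q i.castSucc) (hq := fun i => hq i.castSucc)
    have := hq (Fin.last k)
    rw [causalProduct]
    exact Kernel.IsMarkovKernel.map _ Seq.measurable_append

theorem causalProduct_succ_apply {k : ℕ}
    (q : (i : Fin (k + 1)) → Kernel (Seq X (i + 1) × Seq Y i) (Y i))
    [hq : ∀ i, IsMarkovKernel (q i)] (x : Seq X (k + 1)) :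
    causalProduct (k + 1) q x =
      (causalProduct k (fun i => q i.castSucc) (Seq.restrict k.le_succ x) ⊗ₘ
        (q (Fin.last k) : Kernel (Seq X (k + 1) × Seq Y k) (Y k)).sectR x).map Seq.append := by
  have := isMarkovKernel_causalProduct k (fun i => q i.castSucc) (hq := fun i => hq i.castSucc)
  have := hq (Fin.last k)
  rw [causalProduct, Kernel.map_apply _ Seq.measurable_append,
    Kernel.compProd_apply_eq_compProd_sectR, Kernel.comap_apply]

theorem map_restrict_causalProduct {k m : ℕ} (h : k ≤ m)
    (q : (i : Fin m) → Kernel (Seq X (i + 1) × Seq Y i) (Y i))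
    [hq : ∀ i, IsMarkovKernel (q i)] (x : Seq X m) :
    (causalProduct m q x).map (Seq.restrict h) =
      causalProduct k (fun i => q (Fin.castLE h i)) (Seq.restrict h x) := by
  induction m, h using Nat.le_induction with
  | base => exact Measure.map_id
  | succ m h ih =>
    have := hq (Fin.last m)
    have := isMarkovKernel_causalProduct m (fun i => q i.castSucc) (hq := fun i => hq i.castSucc)
    have hcomp : Seq.restrict (X := Y) (h.trans m.le_succ) ∘ Seq.append =
        Seq.restrict h ∘ Prod.fst := funext fun p => Seq.restrict_append h p
    rw [causalProduct_succ_apply, Measure.map_map (Seq.measurable_restrict _)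
      Seq.measurable_append, hcomp, ← Measure.map_map (Seq.measurable_restrict h) measurable_fst]
    refine (congrArg _ (Measure.fst_compProd _ _)).trans ?_
    exact ih (fun i => q i.castSucc) (hq := fun i => hq i.castSucc) (Seq.restrict m.le_succ x)

theorem exists_eq_map_append_compProd {α : Type*} [MeasurableSpace α] {k : ℕ}
    [StandardBorelSpace (Y k)] [Nonempty (Y k)]
    [MeasurableSpace.CountableOrCountablyGenerated α (Seq Y k)]
    (κ : Kernel α (Seq Y (k + 1))) [IsFiniteKernel κ] :
    ∃ η : Kernel (α × Seq Y k) (Y k), IsMarkovKernel η ∧ ∀ x,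
      κ x = ((κ x).map (Seq.restrict k.le_succ) ⊗ₘ η.sectR x).map Seq.append := by
  let split : Seq Y (k + 1) → Seq Y k × Y k := fun y => (Seq.restrict k.le_succ y, y (Fin.last k))
  have hrestrict := Seq.measurable_restrict (X := Y) k.le_succ
  have hsplit : Measurable split := hrestrict.prodMk (measurable_pi_apply _)
  have happend : Seq.append ∘ split = id := funext Seq.append_restrict
  have hfst : (κ.map split).fst = κ.map (Seq.restrict k.le_succ) := by
    rw [Kernel.fst_eq, ← Kernel.map_comp_right _ hsplit measurable_fst]
    rfl
  refine ⟨(κ.map split).condKernel, inferInstance, fun x => ?_⟩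
  rw [← Kernel.map_apply _ hrestrict, ← hfst, ← Kernel.compProd_apply_eq_compProd_sectR,
    (κ.map split).disintegrate, Kernel.map_apply _ hsplit,
    Measure.map_map Seq.measurable_append hsplit, happend, Measure.map_id]

theorem exists_causalProduct_succ {k : ℕ} [StandardBorelSpace (Y k)] [Nonempty (Y k)]
    [MeasurableSpace.CountableOrCountablyGenerated (Seq X (k + 1)) (Seq Y k)]
    (κ : Kernel (Seq X (k + 1)) (Seq Y (k + 1))) [IsFiniteKernel κ]
    (q : (i : Fin k) → Kernel (Seq X (i + 1) × Seq Y i) (Y i))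
    [hq : ∀ i, IsMarkovKernel (q i)] :
    ∃ q' : (i : Fin (k + 1)) → Kernel (Seq X (i + 1) × Seq Y i) (Y i),
      (∀ i, IsMarkovKernel (q' i)) ∧ ∀ x,
        (κ x).map (Seq.restrict k.le_succ) = causalProduct k q (Seq.restrict k.le_succ x) →
          κ x = causalProduct (k + 1) q' x := by
  obtain ⟨η, hη, hκ⟩ := exists_eq_map_append_compProd κ
  let q' : (i : Fin (k + 1)) → Kernel (Seq X (i + 1) × Seq Y i) (Y i) :=
    Fin.snoc (α := fun i : Fin (k + 1) => Kernel (Seq X (i + 1) × Seq Y i) (Y i)) q η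
  have hcastSucc (i : Fin k) : q' i.castSucc = q i :=
    Fin.snoc_castSucc (α := fun i : Fin (k + 1) => Kernel (Seq X (i + 1) × Seq Y i) (Y i)) _ _ i
  have hlast : q' (Fin.last k) = η :=
    Fin.snoc_last (α := fun i : Fin (k + 1) => Kernel (Seq X (i + 1) × Seq Y i) (Y i)) _ _
  have hq' (i : Fin (k + 1)) : IsMarkovKernel (q' i) :=
    Fin.lastCases (hlast.symm ▸ hη) (fun i => (hcastSucc i).symm ▸ hq i) i
  refine ⟨q', hq', fun x hx => ?_⟩
  rw [causalProduct_succ_apply, hlast, funext hcastSucc, ← hx]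
  exact hκ x

theorem eq_of_isProbabilityMeasure_of_subsingleton {α : Type*} [MeasurableSpace α]
    [Subsingleton α] (μ ν : Measure α) [IsProbabilityMeasure μ] [IsProbabilityMeasure ν] :
    μ = ν := by
  ext s
  exact Subsingleton.set_cases (by simp) (by simp) s

theorem exists_ae_map_restrict_eq_causalProduct [∀ i, StandardBorelSpace (Y i)] {m : ℕ}
    {μ : ProbabilityMeasure (Seq X m)} (P : CondDist μ (Seq Y m))
    (hP : ∀ k (hk : k ≤ m), P.FactorsThrough (Seq.restrict hk) (Seq.restrict hk))
    {k : ℕ} (hk : k ≤ m) :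
    ∃ q : (i : Fin k) → Kernel (Seq X (i + 1) × Seq Y i) (Y i), (∀ i, IsMarkovKernel (q i)) ∧
      ∀ᵐ x ∂(μ : Measure (Seq X m)),
        (P.1 x).map (Seq.restrict hk) = causalProduct k q (Seq.restrict hk x) := by
  induction k with
  | zero =>
    have := P.2
    refine ⟨fun i => i.elim0, fun i => i.elim0, ae_of_all _ fun x => ?_⟩
    have := Measure.isProbabilityMeasure_map (μ := P.1 x) (Seq.measurable_restrict hk).aemeasurable
    have := isMarkovKernel_causalProduct (X := X) (Y := Y) 0 (fun i => i.elim0)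
      (hq := fun i => i.elim0)
    exact eq_of_isProbabilityMeasure_of_subsingleton _ _
  | succ k ih =>
    have : Nonempty (Y k) := P.nonempty.map fun y => y ⟨k, hk⟩
    obtain ⟨q, _, hPq⟩ := ih (k.le_succ.trans hk)
    obtain ⟨κ, _, hPκ⟩ := hP (k + 1) hk
    obtain ⟨q', hq', hκq'⟩ := exists_causalProduct_succ κ q
    refine ⟨q', hq', ?_⟩
    filter_upwards [hPq, hPκ] with x hxq hxκ
    rw [hxκ]
    refine hκq' _ ?_
    rw [← hxκ, Measure.map_map (Seq.measurable_restrict _) (Seq.measurable_restrict _)]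
    exact hxq

theorem mem_realizable_iff [∀ i, StandardBorelSpace (Y i)] {n : ℕ}
    {μ : ProbabilityMeasure (Seq X (n + 1))} (P : CondDist μ (Seq Y (n + 1))) :
    P ∈ realizable μ ↔
      ∀ k (hk : k ≤ n + 1), P.FactorsThrough (Seq.restrict hk) (Seq.restrict hk) := by
  constructor
  · rintro ⟨q, hq, hPq⟩ k hk
    refine ⟨causalProduct k fun i => q (Fin.castLE hk i),
      isMarkovKernel_causalProduct _ _ (hq := fun i => hq _), ?_⟩
    filter_upwards [hPq] with x hx
    rw [hx, map_restrict_causalProduct]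
  · intro h
    obtain ⟨q, hq, hPq⟩ := exists_ae_map_restrict_eq_causalProduct P h le_rfl
    exact ⟨q, hq, hPq.mono fun x hx => Measure.map_id.symm.trans hx⟩

theorem isClosed_realizable
    [∀ i, TopologicalSpace (X i)] [∀ i, TopologicalSpace.PseudoMetrizableSpace (X i)]
    [∀ i, SecondCountableTopology (X i)] [∀ i, BorelSpace (X i)]
    [∀ i, TopologicalSpace (Y i)] [∀ i, PolishSpace (Y i)] [∀ i, BorelSpace (Y i)]
    {n : ℕ} {μ : ProbabilityMeasure (Seq X (n + 1))} : IsClosed (realizable (Y := Y) μ) := by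
  have hrealizable : realizable (Y := Y) μ = ⋂ (k : ℕ) (hk : k ≤ n + 1),
      {P | P.FactorsThrough (Seq.restrict hk) (Seq.restrict hk)} := by
    ext P
    simp only [mem_realizable_iff, Set.mem_iInter, Set.mem_ofPred_eq]
  rw [hrealizable]
  exact isClosed_iInter fun k => isClosed_iInter fun hk =>
    CondDist.isClosed_setOf_factorsThrough (Seq.measurable_restrict hk) (Seq.continuous_restrict hk)

theorem measurable_distortion {n : ℕ}
    {ρ : (i : Fin (n + 1)) → Seq X (i + 1) × Seq Y (i + 1) → ℝ≥0} (hρ : ∀ i, Measurable (ρ i)) :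
    Measurable fun p : Seq X (n + 1) × Seq Y (n + 1) => distortion ρ p.1 p.2 :=
  Finset.measurable_sum _ fun i _ => (hρ i).comp
    ((Seq.measurable_restrict i.isLt).prodMap (Seq.measurable_restrict i.isLt))

theorem isClosed_fidelity
    [∀ i, TopologicalSpace (X i)] [∀ i, TopologicalSpace.PseudoMetrizableSpace (X i)]
    [∀ i, SecondCountableTopology (X i)] [∀ i, BorelSpace (X i)]
    [∀ i, TopologicalSpace (Y i)] [∀ i, PolishSpace (Y i)] [∀ i, BorelSpace (Y i)]
    {n : ℕ} [CompactSpace (Seq Y (n + 1))] {μ : ProbabilityMeasure (Seq X (n + 1))}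
    {ρ : (i : Fin (n + 1)) → Seq X (i + 1) × Seq Y (i + 1) → ℝ≥0} (hρ : ∀ i, Measurable (ρ i))
    (hc : ∀ x, Continuous (distortion ρ x)) (D : ℝ≥0) : IsClosed (fidelity μ ρ D) :=
  ((CondDist.lowerSemicontinuous_lintegral (measurable_distortion hρ) hc).isClosed_preimage D).inter
    isClosed_realizable

end CausalProduct

end CausalRDF

theorem lemma2 {X Y : ℕ → Type*}
    [∀ i, TopologicalSpace (X i)] [∀ i, PolishSpace (X i)]
    [∀ i, MeasurableSpace (X i)] [∀ i, BorelSpace (X i)]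
    [∀ i, TopologicalSpace (Y i)] [∀ i, PolishSpace (Y i)]
    [∀ i, MeasurableSpace (Y i)] [∀ i, BorelSpace (Y i)]
    (n : ℕ) [CompactSpace (CausalRDF.Seq Y (n + 1))]
    (μ : ProbabilityMeasure (CausalRDF.Seq X (n + 1))) :
    (IsCompact (Set.univ : Set (CausalRDF.CondDist μ (CausalRDF.Seq Y (n + 1)))) ∧
      IsClosed (CausalRDF.realizable (Y := Y) μ) ∧
      IsCompact (CausalRDF.realizable (Y := Y) μ)) ∧
    ∀ (ρ : (i : Fin (n + 1)) → CausalRDF.Seq X (i + 1) × CausalRDF.Seq Y (i + 1) → ℝ≥0)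
      (D : ℝ≥0),
      (∀ i, Measurable (ρ i)) →
      (∀ x, Continuous (CausalRDF.distortion ρ x)) →
      (∃ x y, CausalRDF.distortion ρ x y < D) →
      CausalRDF.fidelity μ ρ D ⊆ CausalRDF.realizable μ ∧
        IsClosed (CausalRDF.fidelity μ ρ D) ∧
        IsCompact (CausalRDF.fidelity μ ρ D) := by
  have hrealizable := CausalRDF.isClosed_realizable (Y := Y) (μ := μ)
  refine ⟨⟨isCompact_univ, hrealizable, hrealizable.isCompact⟩, fun ρ D hρ hc _ => ?_⟩
  have hfidelity := CausalRDF.isClosed_fidelity (μ := μ) hρ hc D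
  exact ⟨Set.inter_subset_right, hfidelity, hfidelity.isCompact⟩
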